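/- Let $n,m\ge 0$ be integers and let $G$ be a random hash function: a finite family of $\mathbb F_2$-linear maps $g:\{0,1\}^n\to\{0,1\}^m$ with probabilities $\Pr(G=g)$. Assume that $G$ is universal$_2$, i.e. $\Pr(G(a)=G(a'))\le 2^{-m}$ for all $a\ne a'$. Let $\rho_{AE}=\sum_{a\in\{0,1\}^n}|a\rangle\langle a|_A\otimes\rho_E^a$ be a sub-normalized classical-quantum state (positive semi-definite, $\mathrm{Tr}\,\rho_{AE}\le 1$), where $\mathcal H_E$ is finite-dimensional. Put $\rho_E=\sum_a\rho_E^a$ and $$\rho_{KEG}^{\rm fin}=\sum_g\Pr(G=g)\sum_{k\in\{0,1\}^m}|k\rangle\langle k|_K\otimes\Big(\sum_{a\in g^{-1}(k)}\rho_E^a\Big)\otimes|g\rangle\langle g|_G,$$ $$\rho_{KEG}^{\rm ideal}=\sum_g\Pr(G=g)\,2^{-m}\sum_{k}|k\rangle\langle k|_K\otimes\rho_E\otimes|g\rangle\langle g|_G,$$ and $d_1(\rho_{KEG}^{\rm fin})=\|\rho_{KEG}^{\rm fin}-\rho_{KEG}^{\rm ideal}\|_1$, where $\|M\|_1=\mathrm{Tr}\sqrt{M^\dagger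 M}$. For a sub-normalized state $\tau_{AE}$ let $H_{\min}(\tau_{AE}|E)\in(-\infty,\infty]$ be the supremum of the real numbers $\lambda$ such that $\tau_{AE}\le 2^{-\lambda}\,\mathbb I_A\otimes\sigma_E$ for some state $\sigma_E$ with $\mathrm{Tr}\,\sigma_E=1$. For $\varepsilon\ge 0$ let $H_{\min}^{\varepsilon}(\rho_{AE}|E)$ be the supremum of $H_{\min}(\tau_{AE}|E)$ over all sub-normalized states $\tau_{AE}$ with $P(\tau_{AE},\rho_{AE})\le\varepsilon$, where $P(\rho,\tau)=\sqrt{1-F(\rho,\tau)^2}$ is the purified distance and $F(\rho,\tau)=\|\sqrt\rho\sqrt\tau\|_1+\sqrt{(1-\mathrm{Tr}\,\rho)(1-\mathrm{Tr}\,\tau)}$ is the generalized fidelity. Then for every $\varepsilon\ge 0$, $$d_1(\rho_{KEG}^{\rm fin})\le 2\varepsilon+2^{\frac12\left[m-H_{\min}^{\varepsilon}(\rho_{AE}|E)+3\right]},$$ with the convention $2^{-\infty}=0$. -/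

import Mathlib

open scoped Kronecker ENNReal ComplexOrder

noncomputable section

namespace PrivacyAmplification

/-! ### Finite-dimensional quantum states -/

section States

variable {X Y E : Type*} [Fintype X] [DecidableEq X] [Fintype Y] [DecidableEq Y]
  [Fintype E] [DecidableEq E]

/-- The square root `√M` of a positive semi-definite matrix, by functional calculus. -/
def psdSqrt (M : Matrix X X ℂ) : Matrix X X ℂ := cfc Real.sqrt M

/-- The 1-norm `‖M‖₁ = Tr √(M† M)`. -/
def traceNorm (M : Matrix X X ℂ) : ℝ := (psdSqrt (M.conjTranspose * M)).trace.re

/-- A normalized state: positive semi-definite with trace one. -/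
def IsNormalized (ρ : Matrix X X ℂ) : Prop := ρ.PosSemidef ∧ ρ.trace = 1

/-- A sub-normalized state: positive semi-definite with trace at most one. -/
def IsSubnormalized (ρ : Matrix X X ℂ) : Prop := ρ.PosSemidef ∧ ρ.trace.re ≤ 1

/-- The generalized fidelity
`F(ρ, τ) = ‖√ρ √τ‖₁ + √((1 - Tr ρ) (1 - Tr τ))` of sub-normalized states. -/
def fidelity (ρ τ : Matrix X X ℂ) : ℝ :=
  traceNorm (psdSqrt ρ * psdSqrt τ) + Real.sqrt ((1 - ρ.trace.re) * (1 - τ.trace.re))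

/-- The purified distance `P(ρ, τ) = √(1 - F(ρ, τ)²)`. -/
def purifiedDistance (ρ τ : Matrix X X ℂ) : ℝ := Real.sqrt (1 - fidelity ρ τ ^ 2)

/-- The conditional min-entropy `H_min(ρ_AE|E)`: the largest `r` with
`ρ_AE ≤ 2^(-r) I_A ⊗ σ_E` for some normalized state `σ_E`. It is `⊤` for `ρ_AE = 0`. -/
def minEntropy (ρ : Matrix (X × E) (X × E) ℂ) : EReal :=
  ⨆ (r : ℝ) (_ : ∃ σ : Matrix E E ℂ, IsNormalized σ ∧
    (((((2 : ℝ) ^ (-r) : ℝ) : ℂ) • ((1 : Matrix X X ℂ) ⊗ₖ σ)) - ρ).PosSemidef), (r : EReal)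

/-- The smooth conditional min-entropy `H_min^ε(ρ_AE|E)`: the largest min-entropy of
a sub-normalized state on `AE` within purified distance `ε` of `ρ_AE`. -/
def smoothMinEntropy (ε : ℝ) (ρ : Matrix (X × E) (X × E) ℂ) : EReal :=
  ⨆ (τ : Matrix (X × E) (X × E) ℂ)
    (_ : IsSubnormalized τ ∧ purifiedDistance τ ρ ≤ ε), minEntropy τ

/-- The classical-quantum operator `∑ₓ |x⟩⟨x| ⊗ ρˣ`. -/
def cqState (ρ : X → Matrix E E ℂ) : Matrix (X × E) (X × E) ℂ :=
  ∑ x, Matrix.single x x (1 : ℂ) ⊗ₖ ρ x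

end States

/-! ### Privacy amplification by random linear hashing -/

/-- A random linear hash function `{0,1}ⁿ → {0,1}ᵐ`: a finite family of linear maps
together with the probability of choosing each of them. -/
structure RandomHash (n m : ℕ) (G : Type*) [Fintype G] where
  fn : G → (Fin n → ZMod 2) →ₗ[ZMod 2] (Fin m → ZMod 2)
  prob : G → ℝ
  prob_nonneg : ∀ g, 0 ≤ prob g
  prob_sum : ∑ g, prob g = 1

namespace RandomHash

variable {n m : ℕ} {G E : Type*} [Fintype G] [DecidableEq G] [Fintype E] [DecidableEq E]

/-- Universal₂: `Pr(G(a) = G(a')) ≤ 2^(-m)` for all `a ≠ a'`. -/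
def IsUniversalTwo {n m : ℕ} {G : Type*} [Fintype G] (H : RandomHash n m G) : Prop :=
  ∀ a a' : Fin n → ZMod 2, a ≠ a' →
    ∑ g, H.prob g * (if H.fn g a = H.fn g a' then 1 else 0) ≤ ((2 : ℝ) ^ m)⁻¹

/-- `ρ_KE^{fin,g} = ∑ₖ |k⟩⟨k| ⊗ ∑_{a ∈ g⁻¹(k)} ρᵃ`: the state of key and eavesdropper after
hashing the string `a` of `∑ₐ |a⟩⟨a| ⊗ ρᵃ` with the function `g`. -/
def finalKE (H : RandomHash n m G) (ρ : (Fin n → ZMod 2) → Matrix E E ℂ) (g : G) :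
    Matrix ((Fin m → ZMod 2) × E) ((Fin m → ZMod 2) × E) ℂ :=
  cqState fun k => ∑ a with H.fn g a = k, ρ a

/-- `ρ_KE^{ideal} = 2^(-m) ∑ₖ |k⟩⟨k| ⊗ ρ_E` with `ρ_E = ∑ₐ ρᵃ`. -/
def idealKE (m : ℕ) (ρ : (Fin n → ZMod 2) → Matrix E E ℂ) :
    Matrix ((Fin m → ZMod 2) × E) ((Fin m → ZMod 2) × E) ℂ :=
  ((2 : ℂ) ^ m)⁻¹ • cqState fun _ => ∑ a, ρ a

/-- `ρ_KEG^{fin} = ∑_g Pr(G = g) ρ_KE^{fin,g} ⊗ |g⟩⟨g|`. -/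
def finalKEG (H : RandomHash n m G) (ρ : (Fin n → ZMod 2) → Matrix E E ℂ) :
    Matrix (((Fin m → ZMod 2) × E) × G) (((Fin m → ZMod 2) × E) × G) ℂ :=
  ∑ g, (H.prob g : ℂ) • (H.finalKE ρ g ⊗ₖ Matrix.single g g (1 : ℂ))

/-- `ρ_KEG^{ideal} = ∑_g Pr(G = g) ρ_KE^{ideal} ⊗ |g⟩⟨g|`. -/
def idealKEG (H : RandomHash n m G) (ρ : (Fin n → ZMod 2) → Matrix E E ℂ) :
    Matrix (((Fin m → ZMod 2) × E) × G) (((Fin m → ZMod 2) × E) × G) ℂ :=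
  ∑ g, (H.prob g : ℂ) • (idealKE m ρ ⊗ₖ Matrix.single g g (1 : ℂ))

/-- `d₁(ρ_KEG^{fin}) = ‖ρ_KEG^{fin} - ρ_KEG^{ideal}‖₁`. -/
def d1 (H : RandomHash n m G) (ρ : (Fin n → ZMod 2) → Matrix E E ℂ) : ℝ :=
  traceNorm (H.finalKEG ρ - H.idealKEG ρ)

end RandomHash

/-- `2 ^ x` for an extended real `x`, with `2 ^ (-∞) = 0` and `2 ^ ∞ = ∞`. -/
def exp2 (x : EReal) : ℝ≥0∞ := EReal.exp ((Real.log 2 : ℝ) * x)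

end PrivacyAmplification

end

/-! Fix a state `τ` within `ε` of `ρ` with `τ ≤ c (1 ⊗ σ)`. Nearly optimal purifications `M`, `N` of
`ρ`, `τ` with fidelity `F` satisfy `‖M - F N‖₂² ≤ 1 - F²`. Cut them into blocks indexed by `a`: the
operator bound gives `N_a = √σ B_a` with `B_a B_aᴴ ≤ c`, so `M_a = F √σ B_a + D_a` and `ρ_a = F √σ
B_a M_aᴴ + F D_a (√σ B_a)ᴴ + D_a D_aᴴ`. The 1-norm is tested against a contraction `W` from the
polar decomposition, and the three terms are bounded separately. The last is quadratic in the error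
and contributes at most `2 ∑ ‖D_a‖₂² ≤ 2ε`, with no use of hashing (`sum_trace_deviation_self_le`).
Each of the other two contributes at most `√(2^m · 2c)`: Cauchy-Schwarz removes `√σ`, and the rest
is a variance under hashing (`abs_sum_trace_deviation_le`).

The operators `B_a M_aᴴ` have no sign, so a one-sided collision bound does not control this
variance. Linearity does: the covariance kernel depends only on `a - b`, and its absolute sum is at
most 2, because a linear map to `m` bits vanishes on at least `2^(n-m)` points and the collision
probabilities therefore cannot fall far below `2^(-m)` in total (`sum_abs_vanishProb_sub_le`,
`variance_le`). No classicality of `τ` is needed. -/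

namespace PrivacyAmplification
open Matrix

/-! ### Hilbert-Schmidt norm inequalities -/

section HilbertSchmidt

variable {X Y Z : Type*} [Fintype X] [Fintype Y] [Fintype Z]

/-- The squared Hilbert-Schmidt norm. -/
noncomputable def hsSq (A : Matrix X Y ℂ) : ℝ := ∑ i, ∑ j, ‖A i j‖ ^ 2

theorem hsSq_nonneg (A : Matrix X Y ℂ) : 0 ≤ hsSq A := by
  unfold hsSq; positivity

theorem hsSq_eq_trace (A : Matrix X Y ℂ) : hsSq A = (A * Aᴴ).trace.re := by
  simp only [hsSq, Matrix.trace, Matrix.diag, Matrix.mul_apply, Complex.re_sum,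
    Matrix.conjTranspose_apply]
  refine Finset.sum_congr rfl fun i _ => Finset.sum_congr rfl fun j _ => ?_
  rw [Complex.star_def, Complex.mul_conj, Complex.ofReal_re, Complex.normSq_eq_norm_sq]

theorem hsSq_conjTranspose (A : Matrix X Y ℂ) : hsSq Aᴴ = hsSq A := by
  simp only [hsSq, Matrix.conjTranspose_apply, norm_star]
  exact Finset.sum_comm

theorem norm_trace_mul_sq_le (A : Matrix X Y ℂ) (B : Matrix Y X ℂ) :
    ‖(A * B).trace‖ ^ 2 ≤ hsSq A * hsSq B := by
  have h1 : ‖(A * B).trace‖ ≤ ∑ p : X × Y, ‖A p.1 p.2‖ * ‖B p.2 p.1‖ := by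
    rw [Fintype.sum_prod_type]
    refine (norm_sum_le _ _).trans (Finset.sum_le_sum fun i _ => ?_)
    rw [Matrix.diag, Matrix.mul_apply]
    refine (norm_sum_le _ _).trans (Finset.sum_le_sum fun j _ => ?_)
    rw [norm_mul]
  have h2 := Finset.sum_mul_sq_le_sq_mul_sq (Finset.univ : Finset (X × Y))
    (fun p => ‖A p.1 p.2‖) (fun p => ‖B p.2 p.1‖)
  have hA : hsSq A = ∑ p : X × Y, ‖A p.1 p.2‖ ^ 2 := by
    rw [Fintype.sum_prod_type]; rfl
  have hB : hsSq B = ∑ p : X × Y, ‖B p.2 p.1‖ ^ 2 := by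
    rw [Fintype.sum_prod_type_right]; rfl
  rw [hA, hB]
  exact (pow_le_pow_left₀ (norm_nonneg _) h1 2).trans h2

theorem norm_trace_mul_le (A : Matrix X Y ℂ) (B : Matrix Y X ℂ) :
    ‖(A * B).trace‖ ≤ √(hsSq A) * √(hsSq B) := by
  rw [← Real.sqrt_mul (hsSq_nonneg A)]
  exact Real.le_sqrt_of_sq_le (norm_trace_mul_sq_le A B)

/-- Conjugate the positive operator `c - B Bᴴ` by `A` and take the trace. -/
theorem hsSq_mul_le [DecidableEq Y] {c : ℝ} {B : Matrix Y Z ℂ}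
    (hB : ((c : ℂ) • (1 : Matrix Y Y ℂ) - B * Bᴴ).PosSemidef) (A : Matrix X Y ℂ) :
    hsSq (A * B) ≤ c * hsSq A := by
  have h := (Complex.le_def.mp (hB.mul_mul_conjTranspose_same A).trace_nonneg).1
  have e : A * ((c : ℂ) • (1 : Matrix Y Y ℂ) - B * Bᴴ) * Aᴴ
      = (c : ℂ) • (A * Aᴴ) - (A * B) * (A * B)ᴴ := by
    simp [Matrix.mul_sub, Matrix.sub_mul, Matrix.mul_assoc]
  rw [e, Matrix.trace_sub, Matrix.trace_smul, smul_eq_mul, Complex.sub_re,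
    Complex.re_ofReal_mul, ← hsSq_eq_trace, ← hsSq_eq_trace, Complex.zero_re] at h
  linarith

/-- An operator and its adjoint have the same norm: `‖A Bᴴ‖₂² = ⟨A, A Bᴴ B⟩`, then Cauchy-Schwarz
and cancellation of one factor `‖A Bᴴ‖₂²`. -/
theorem hsSq_mul_conjTranspose_le {c : ℝ} (hc : 0 ≤ c) {B : Matrix Y Z ℂ}
    (hB : ∀ A : Matrix X Y ℂ, hsSq (A * B) ≤ c * hsSq A) (A : Matrix X Z ℂ) :
    hsSq (A * Bᴴ) ≤ c * hsSq A := by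
  have h1 := hB (A * Bᴴ)
  have h2 := norm_trace_mul_sq_le A ((A * Bᴴ) * B)ᴴ
  rw [hsSq_conjTranspose] at h2
  have e : A * ((A * Bᴴ) * B)ᴴ = (A * Bᴴ) * (A * Bᴴ)ᴴ := by
    simp [Matrix.mul_assoc]
  rw [e] at h2
  have h3 : hsSq (A * Bᴴ) ^ 2 ≤ hsSq A * hsSq (A * Bᴴ * B) := by
    refine le_trans ?_ h2
    rw [hsSq_eq_trace (A * Bᴴ)]
    rw [← sq_abs]
    exact pow_le_pow_left₀ (abs_nonneg _) (Complex.abs_re_le_norm _) 2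
  have h0 := hsSq_nonneg (A * Bᴴ)
  have hA := hsSq_nonneg A
  rcases h0.eq_or_lt with h | h
  · rw [← h]; positivity
  · nlinarith [mul_le_mul_of_nonneg_left h1 hA]

theorem hsSq_submatrix_id_le {Y' : Type*} [Fintype Y'] (A : Matrix X Y ℂ)
    {g : Y' → Y} (hg : g.Injective) : hsSq (A.submatrix id g) ≤ hsSq A := by
  classical
  refine Finset.sum_le_sum fun i _ => ?_
  have := Finset.sum_image (s := Finset.univ) (f := fun j => ‖A i j‖ ^ 2) (g := g)
    (fun a _ b _ h => hg h)
  simp only [Matrix.submatrix_apply, id]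
  rw [← this]
  exact Finset.sum_le_sum_of_subset_of_nonneg (Finset.subset_univ _) fun _ _ _ => by positivity

theorem hsSq_eq_zero {A : Matrix X Y ℂ} (h : hsSq A ≤ 0) : A = 0 := by
  have h0 := h.antisymm (hsSq_nonneg A)
  ext i j
  have h1 := (Finset.sum_eq_zero_iff_of_nonneg fun i _ => by positivity).mp h0 i (Finset.mem_univ i)
  have h2 := (Finset.sum_eq_zero_iff_of_nonneg fun j _ => by positivity).mp h1 j (Finset.mem_univ j)
  simpa using h2

end HilbertSchmidt

/-! ### Pseudo-inverses, Douglas factorization and polar decomposition -/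

section Pinv
variable {X Y : Type*} [Fintype X] [DecidableEq X]

theorem continuousOn_spectrum (A : Matrix X X ℂ) (f : ℝ → ℝ) :
    ContinuousOn f (spectrum ℝ A) :=
  (Matrix.finite_real_spectrum (A := A)).continuousOn f

theorem psdSqrt_isHermitian (A : Matrix X X ℂ) : (psdSqrt A)ᴴ = psdSqrt A :=
  (cfc_predicate Real.sqrt A : IsSelfAdjoint _)

theorem psdSqrt_mul_self {A : Matrix X X ℂ} (hA : A.PosSemidef) : psdSqrt A * psdSqrt A = A := by
  have hs : IsSelfAdjoint A := hA.isHermitian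
  rw [psdSqrt, ← cfc_mul _ _ A (continuousOn_spectrum A _) (continuousOn_spectrum A _)]
  conv_rhs => rw [← cfc_id ℝ A]
  refine cfc_congr fun x hx => ?_
  have : 0 ≤ x := by
    rw [hA.isHermitian.spectrum_real_eq_range_eigenvalues] at hx
    obtain ⟨i, rfl⟩ := hx
    exact hA.eigenvalues_nonneg i
  simp [Real.mul_self_sqrt this]

/-- The pseudo-inverse of `√A` and the projection onto the kernel of `A`. -/
theorem exists_pseudoInverse_psdSqrt (A : Matrix X X ℂ) (hA : A.PosSemidef) :
    ∃ T Q : Matrix X X ℂ, Tᴴ = T ∧ Qᴴ = Q ∧ Q * Q = Q ∧ T * psdSqrt A = 1 - Q ∧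
      psdSqrt A * T = 1 - Q ∧ Q * psdSqrt A = 0 ∧ psdSqrt A * Q = 0 := by
  have hs : IsSelfAdjoint A := hA.isHermitian
  refine ⟨cfc (fun x => (√x)⁻¹) A, cfc (fun x : ℝ => if √x = 0 then (1 : ℝ) else 0) A,
    (cfc_predicate _ A : IsSelfAdjoint _), (cfc_predicate _ A : IsSelfAdjoint _),
    ?_, ?_, ?_, ?_, ?_⟩
  · rw [← cfc_mul _ _ A (continuousOn_spectrum A _) (continuousOn_spectrum A _)]
    refine cfc_congr fun x _ => ?_
    by_cases h : √x = 0 <;> simp [h]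
  · rw [psdSqrt, ← cfc_mul _ _ A (continuousOn_spectrum A _) (continuousOn_spectrum A _),
      ← cfc_one ℝ A, ← cfc_sub _ _ A (continuousOn_spectrum A _) (continuousOn_spectrum A _)]
    refine cfc_congr fun x _ => ?_
    by_cases h : √x = 0 <;> simp [h]
  · rw [psdSqrt, ← cfc_mul _ _ A (continuousOn_spectrum A _) (continuousOn_spectrum A _),
      ← cfc_one ℝ A, ← cfc_sub _ _ A (continuousOn_spectrum A _) (continuousOn_spectrum A _)]
    refine cfc_congr fun x _ => ?_
    by_cases h : √x = 0 <;> simp [h]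
  · rw [psdSqrt, ← cfc_mul _ _ A (continuousOn_spectrum A _) (continuousOn_spectrum A _),
      ← cfc_zero ℝ A]
    refine cfc_congr fun x _ => ?_
    by_cases h : √x = 0 <;> simp [h]
  · rw [psdSqrt, ← cfc_mul _ _ A (continuousOn_spectrum A _) (continuousOn_spectrum A _),
      ← cfc_zero ℝ A]
    refine cfc_congr fun x _ => ?_
    by_cases h : √x = 0 <;> simp [h]


/-- Douglas factorization through the square root. -/
theorem exists_eq_psdSqrt_mul {Y : Type*} [Fintype Y] {c : ℝ} (hc : 0 ≤ c)
    {σ : Matrix X X ℂ} (hσ : σ.PosSemidef) {N : Matrix X Y ℂ}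
    (h : ((c : ℂ) • σ - N * Nᴴ).PosSemidef) :
    ∃ B : Matrix X Y ℂ, N = psdSqrt σ * B ∧
      ((c : ℂ) • (1 : Matrix X X ℂ) - B * Bᴴ).PosSemidef := by
  obtain ⟨T, Q, hT, hQ, hQQ, hTS, hST, hQS, hSQ⟩ := exists_pseudoInverse_psdSqrt σ hσ
  have hσS := psdSqrt_mul_self hσ
  -- `N Nᴴ ≤ c σ` and `Q σ = 0`, so conjugation by `Q` forces `Q N = 0`.
  have hQN : Q * N = 0 := by
    refine hsSq_eq_zero ?_
    have h1 := (Complex.le_def.mp (h.mul_mul_conjTranspose_same Q).trace_nonneg).1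
    have e : Q * ((c : ℂ) • σ - N * Nᴴ) * Qᴴ = - ((Q * N) * (Q * N)ᴴ) := by
      have : Q * σ = 0 := by rw [← hσS, ← Matrix.mul_assoc, hQS, Matrix.zero_mul]
      rw [Matrix.mul_sub, Matrix.mul_smul, this, Matrix.conjTranspose_mul]
      simp [Matrix.mul_assoc]
    rw [e, Matrix.trace_neg, Complex.neg_re, ← hsSq_eq_trace, Complex.zero_re] at h1
    linarith
  refine ⟨T * N, ?_, ?_⟩
  · rw [← Matrix.mul_assoc, hST, Matrix.sub_mul, hQN, Matrix.one_mul, sub_zero]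
  -- `T σ T` is only the projection `1 - Q`; the term `c Q Qᴴ` restores the identity.
  · have e : (c : ℂ) • (1 : Matrix X X ℂ) - (T * N) * (T * N)ᴴ
        = T * ((c : ℂ) • σ - N * Nᴴ) * Tᴴ + (c : ℂ) • (Q * Qᴴ) := by
      have h1 : T * σ * T = 1 - Q := by
        rw [← hσS, ← Matrix.mul_assoc, hTS, Matrix.mul_assoc, hST, Matrix.mul_sub, Matrix.sub_mul,
          Matrix.sub_mul, hQQ]
        simp
      rw [Matrix.mul_sub, Matrix.sub_mul, hT, hQ, hQQ, Matrix.mul_smul, Matrix.smul_mul, h1,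
        smul_sub, Matrix.conjTranspose_mul, hT]
      simp only [Matrix.mul_assoc]
      abel
    rw [e]
    exact (h.mul_mul_conjTranspose_same T).add
      ((Matrix.posSemidef_self_mul_conjTranspose Q).smul (by exact_mod_cast hc))

/-- The polar decomposition, with the unitary replaced by a partial isometry `W`;
`Q` is the projection onto the orthogonal complement of its range. -/
theorem exists_trace_mul_eq_traceNorm (A : Matrix X X ℂ) :
    ∃ W Q : Matrix X X ℂ, W * Wᴴ + Q * Qᴴ = 1 ∧ (A * W).trace.re = traceNorm A := by
  have hA := Matrix.posSemidef_conjTranspose_mul_self A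
  obtain ⟨T, Q, hT, hQ, hQQ, hTS, hST, hQS, hSQ⟩ := exists_pseudoInverse_psdSqrt _ hA
  have hS := psdSqrt_mul_self hA
  -- With `T` the pseudo-inverse of `|A|`, the trace of `A T Aᴴ` is that of `|A|² T = |A|`.
  refine ⟨T * Aᴴ, Q, ?_, ?_⟩
  · rw [Matrix.conjTranspose_mul, Matrix.conjTranspose_conjTranspose, hT, hQ, hQQ]
    have : T * Aᴴ * (A * T) = T * (Aᴴ * A) * T := by simp only [Matrix.mul_assoc]
    rw [this, ← hS, ← Matrix.mul_assoc, hTS, Matrix.mul_assoc, hST, Matrix.mul_sub, Matrix.sub_mul,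
      Matrix.sub_mul, hQQ]
    simp
  · rw [← Matrix.mul_assoc, Matrix.trace_mul_comm, ← Matrix.mul_assoc, traceNorm]
    conv_lhs => rw [← hS]
    rw [Matrix.mul_assoc, hST, Matrix.mul_sub, hSQ, Matrix.mul_one, sub_zero]

/-- Purifications of `ρ` and `τ` whose overlap is `‖√τ √ρ‖₁`. -/
theorem exists_purifications {ρ τ : Matrix X X ℂ} (hρ : ρ.PosSemidef) (hτ : τ.PosSemidef) :
    ∃ M N : Matrix X (X ⊕ X) ℂ, M * Mᴴ = ρ ∧ N * Nᴴ = τ ∧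
      (M * Nᴴ).trace.re = traceNorm (psdSqrt τ * psdSqrt ρ) := by
  obtain ⟨W, Q, h1, h2⟩ := exists_trace_mul_eq_traceNorm (psdSqrt τ * psdSqrt ρ)
  -- `W` need not be unitary; the second block supplies the missing part of `ρ` and is invisible to
  -- the overlap with `N`.
  refine ⟨fromCols (psdSqrt ρ * W) (psdSqrt ρ * Q), fromCols (psdSqrt τ) 0, ?_, ?_, ?_⟩
  · rw [conjTranspose_fromCols_eq_fromRows_conjTranspose, fromCols_mul_fromRows,
      Matrix.conjTranspose_mul, Matrix.conjTranspose_mul, psdSqrt_isHermitian]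
    calc _ = psdSqrt ρ * (W * Wᴴ + Q * Qᴴ) * psdSqrt ρ := by
          simp only [Matrix.mul_assoc, Matrix.mul_add, Matrix.add_mul]
      _ = ρ := by rw [h1, Matrix.mul_one, psdSqrt_mul_self hρ]
  · rw [conjTranspose_fromCols_eq_fromRows_conjTranspose, fromCols_mul_fromRows,
      psdSqrt_isHermitian, psdSqrt_mul_self hτ]
    simp
  · rw [conjTranspose_fromCols_eq_fromRows_conjTranspose, fromCols_mul_fromRows,
      psdSqrt_isHermitian, ← h2, Matrix.conjTranspose_zero, Matrix.mul_zero, add_zero,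
      Matrix.trace_mul_comm, Matrix.mul_assoc]

end Pinv

/-! ### Close purifications from the purified distance -/

section Purification
variable {X : Type*} [Fintype X]

theorem hsSq_sub_smul {Y : Type*} [Fintype Y] (M N : Matrix X Y ℂ) (c : ℝ) :
    hsSq (M - (c : ℂ) • N) = hsSq M - 2 * c * (M * Nᴴ).trace.re + c ^ 2 * hsSq N := by
  have h : (N * Mᴴ).trace.re = (M * Nᴴ).trace.re := by
    rw [← Matrix.conjTranspose_conjTranspose N, ← Matrix.conjTranspose_mul, Matrix.trace_conjTranspose,
      Matrix.conjTranspose_conjTranspose]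
    simp
  simp only [hsSq_eq_trace, Matrix.conjTranspose_sub, Matrix.conjTranspose_smul, Matrix.sub_mul,
    Matrix.mul_sub, Matrix.smul_mul, Matrix.mul_smul, Matrix.trace_sub, Matrix.trace_smul,
    smul_eq_mul, Complex.sub_re, Complex.star_def, Complex.conj_ofReal, Complex.re_ofReal_mul, h]
  ring

/-- Sub-normalized states within purified distance `ε` have purifications `M` and `N` such that
`M - cN` is of order `ε` for some `c ∈ [-1, 1]`. -/
theorem exists_close_purifications [DecidableEq X] {ρ τ : Matrix X X ℂ} (hρ : IsSubnormalized ρ)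
    (hτ : IsSubnormalized τ) {ε : ℝ} (h : purifiedDistance τ ρ ≤ ε) :
    ∃ (M N : Matrix X (X ⊕ X) ℂ) (c : ℝ), M * Mᴴ = ρ ∧ N * Nᴴ = τ ∧ |c| ≤ 1 ∧
      hsSq (M - (c : ℂ) • N) ≤ ε ∧ hsSq (M - (c : ℂ) • N) ≤ 1 := by
  obtain ⟨M, N, hM, hN, hMN⟩ := exists_purifications hρ.1 hτ.1
  set F := fidelity τ ρ with hF
  have hF' : F = (M * Nᴴ).trace.re + √(1 - τ.trace.re) * √(1 - ρ.trace.re) := by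
    rw [hF, fidelity, hMN, Real.sqrt_mul (by linarith [hτ.2])]
  have key : hsSq (M - (F : ℂ) • N) ≤ 1 - F ^ 2 := by
    rw [hsSq_sub_smul, hsSq_eq_trace, hsSq_eq_trace, hM, hN]
    have h1 := Real.sq_sqrt (show 0 ≤ 1 - τ.trace.re by linarith [hτ.2])
    have h2 := Real.sq_sqrt (show 0 ≤ 1 - ρ.trace.re by linarith [hρ.2])
    set a := √(1 - τ.trace.re)
    set b := √(1 - ρ.trace.re)
    have e1 : τ.trace.re = 1 - a ^ 2 := by linarith
    have e2 : ρ.trace.re = 1 - b ^ 2 := by linarith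
    have e3 : (M * Nᴴ).trace.re = F - a * b := by linarith
    rw [e1, e2, e3]
    -- The two sides differ by exactly `(b - F a)²`.
    nlinarith [sq_nonneg (b - F * a)]
  have h0 : 0 ≤ 1 - F ^ 2 := (hsSq_nonneg _).trans key
  have h1 : 1 - F ^ 2 ≤ 1 := by linarith [sq_nonneg F]
  refine ⟨M, N, F, hM, hN, ?_, ?_, key.trans h1⟩
  · rw [← sq_le_one_iff_abs_le_one]; linarith
  · refine key.trans (le_trans ?_ h)
    rw [purifiedDistance]
    -- As `1 - F²` lies in `[0, 1]`, it is at most its own square root.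
    exact Real.le_sqrt_of_sq_le (by nlinarith)

end Purification
end PrivacyAmplification

/-! ### Variance of linear universal₂ hashing -/

namespace PrivacyAmplification
namespace RandomHash
variable {n m : ℕ} {G : Type*} [Fintype G] (H : RandomHash n m G)

/-- The deviation of the indicator of `g(a) = k` from its mean `2^(-m)`. -/
noncomputable def weight (g : G) (k : Fin m → ZMod 2) (a : Fin n → ZMod 2) : ℝ :=
  (if H.fn g a = k then 1 else 0) - ((2 : ℝ) ^ m)⁻¹

/-- The probability that the hash function vanishes at `x`. -/
noncomputable def vanishProb (x : Fin n → ZMod 2) : ℝ :=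
  ∑ g, H.prob g * (if H.fn g x = 0 then 1 else 0)

theorem card_bits (l : ℕ) : (Fintype.card (Fin l → ZMod 2) : ℝ) = 2 ^ l := by
  simp [ZMod.card]

theorem sum_abs_weight_le (g : G) (a : Fin n → ZMod 2) : ∑ k, |H.weight g k a| ≤ 2 := by
  calc ∑ k, |H.weight g k a|
      ≤ ∑ k, ((if H.fn g a = k then 1 else 0) + ((2 : ℝ) ^ m)⁻¹) := by
        refine Finset.sum_le_sum fun k _ => ?_
        unfold weight
        refine (abs_sub _ _).trans (le_of_eq ?_)
        rw [abs_of_nonneg (by positivity : (0 : ℝ) ≤ ((2 : ℝ) ^ m)⁻¹)]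
        split_ifs <;> simp
    _ = 2 := by
        rw [Finset.sum_add_distrib, Finset.sum_ite_eq, Finset.sum_const, Finset.card_univ,
          nsmul_eq_mul, card_bits]
        rw [mul_inv_cancel₀ (by positivity)]
        norm_num

/-- Linearity turns a collision of `a` and `b` into vanishing at `a - b`, making the covariance a
convolution kernel. -/
theorem sum_weight_mul_weight (g : G) (a b : Fin n → ZMod 2) :
    ∑ k, H.weight g k a * H.weight g k b
      = (if H.fn g (a - b) = 0 then 1 else 0) - ((2 : ℝ) ^ m)⁻¹ := by
  have e (k) : H.weight g k a * H.weight g k b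
      = (if H.fn g a = k then (if H.fn g b = k then 1 else 0) else 0)
        - (if H.fn g a = k then ((2 : ℝ) ^ m)⁻¹ else 0)
        - (if H.fn g b = k then ((2 : ℝ) ^ m)⁻¹ else 0)
        + ((2 : ℝ) ^ m)⁻¹ * ((2 : ℝ) ^ m)⁻¹ := by
    unfold weight
    split_ifs <;> ring
  simp only [e, Finset.sum_add_distrib, Finset.sum_sub_distrib, Finset.sum_ite_eq,
    Finset.mem_univ, if_true, Finset.sum_const, Finset.card_univ, nsmul_eq_mul, card_bits]
  rw [← mul_assoc, mul_inv_cancel₀ (by positivity)]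
  simp only [map_sub, sub_eq_zero, eq_comm (a := H.fn g b)]
  ring

theorem sum_prob_sum_weight_mul_weight (a b : Fin n → ZMod 2) :
    ∑ g, H.prob g * ∑ k, H.weight g k a * H.weight g k b
      = H.vanishProb (a - b) - ((2 : ℝ) ^ m)⁻¹ := by
  simp only [sum_weight_mul_weight, mul_sub, Finset.sum_sub_distrib, vanishProb,
    ← Finset.sum_mul, H.prob_sum, one_mul]

/-- The kernel has size `2^n` divided by that of the range, which is at most `2^m`. -/
theorem two_pow_le_card_vanish (g : G) :
    (2 : ℝ) ^ n * ((2 : ℝ) ^ m)⁻¹ ≤ ∑ x, (if H.fn g x = 0 then 1 else 0) := by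
  have h1 : Nat.card (Fin n → ZMod 2)
      = Nat.card (H.fn g).ker * Nat.card (H.fn g).range := by
    rw [Submodule.card_eq_card_quotient_mul_card (H.fn g).ker,
      Nat.card_congr (H.fn g).quotKerEquivRange.toEquiv]
  have h2 : Nat.card (H.fn g).range ≤ Nat.card (Fin m → ZMod 2) :=
    Nat.card_le_card_of_injective _ Subtype.val_injective
  have h3 : (∑ x, (if H.fn g x = 0 then 1 else 0) : ℝ) = Nat.card (H.fn g).ker := by
    classical
    rw [Finset.sum_boole, Nat.card_eq_fintype_card, Fintype.card_subtype]
    simp [LinearMap.mem_ker]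
  rw [Nat.card_eq_fintype_card] at h1
  rw [h3, ← div_eq_mul_inv, div_le_iff₀ (by positivity), ← card_bits n, ← card_bits m, h1,
    ← Nat.card_eq_fintype_card (α := Fin m → ZMod 2)]
  exact_mod_cast Nat.mul_le_mul_left _ h2

/-- Away from 0 every term is nonpositive before taking absolute values, by universality; the kernel
count bounds their total, and 0 is the only positive excess. -/
theorem sum_abs_vanishProb_sub_le (hH : H.IsUniversalTwo) :
    ∑ x, |H.vanishProb x - ((2 : ℝ) ^ m)⁻¹| ≤ 2 := by
  have hm : (1 : ℝ) ≤ 2 ^ m := one_le_pow₀ one_le_two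
  have hm' : ((2 : ℝ) ^ m)⁻¹ ≤ 1 := inv_le_one_of_one_le₀ hm
  have h0 : H.vanishProb 0 = 1 := by simp [vanishProb, H.prob_sum]
  have hx (x : Fin n → ZMod 2) : |H.vanishProb x - ((2 : ℝ) ^ m)⁻¹|
      = ((2 : ℝ) ^ m)⁻¹ - H.vanishProb x + (if x = 0 then 2 * (1 - ((2 : ℝ) ^ m)⁻¹) else 0) := by
    split_ifs with h
    · rw [h, h0, abs_of_nonneg (by linarith)]; ring
    · rw [abs_of_nonpos, add_zero, neg_sub]
      have := hH x 0 h
      simp only [map_zero] at this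
      exact sub_nonpos.mpr this
  have hs : (2 : ℝ) ^ n * ((2 : ℝ) ^ m)⁻¹ ≤ ∑ x, H.vanishProb x := by
    simp only [vanishProb]
    rw [Finset.sum_comm]
    calc (2 : ℝ) ^ n * ((2 : ℝ) ^ m)⁻¹ = ∑ g, H.prob g * ((2 : ℝ) ^ n * ((2 : ℝ) ^ m)⁻¹) := by
          rw [← Finset.sum_mul, H.prob_sum, one_mul]
      _ ≤ _ := by
          refine Finset.sum_le_sum fun g _ => ?_
          rw [← Finset.mul_sum]
          exact mul_le_mul_of_nonneg_left (H.two_pow_le_card_vanish g) (H.prob_nonneg g)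
  simp only [hx, Finset.sum_add_distrib, Finset.sum_sub_distrib, Finset.sum_ite_eq',
    Finset.mem_univ, if_true, Finset.sum_const, Finset.card_univ, nsmul_eq_mul, card_bits]
  have : 0 ≤ ((2 : ℝ) ^ m)⁻¹ := by positivity
  linarith

/-- Hashing with a linear universal₂ family brings any real function on `{0,1}ⁿ` close to its
mean, in quadratic mean. -/
theorem variance_le (hH : H.IsUniversalTwo) (z : (Fin n → ZMod 2) → ℝ) :
    ∑ g, H.prob g * ∑ k, (∑ a, H.weight g k a * z a) ^ 2 ≤ 2 * ∑ a, z a ^ 2 := by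
  have e : ∑ g, H.prob g * ∑ k, (∑ a, H.weight g k a * z a) ^ 2
      = ∑ a, ∑ b, (H.vanishProb (a - b) - ((2 : ℝ) ^ m)⁻¹) * (z a * z b) := by
    have e1 (g) : ∑ k, (∑ a, H.weight g k a * z a) ^ 2
        = ∑ a, ∑ b, (∑ k, H.weight g k a * H.weight g k b) * (z a * z b) := by
      simp only [sq, Fintype.sum_mul_sum]
      rw [Finset.sum_comm]
      refine Finset.sum_congr rfl fun a _ => ?_
      rw [Finset.sum_comm]
      refine Finset.sum_congr rfl fun b _ => ?_
      rw [Finset.sum_mul]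
      exact Finset.sum_congr rfl fun k _ => by ring
    simp only [e1, ← sum_prob_sum_weight_mul_weight]
    calc _ = ∑ g, ∑ a, ∑ b,
          H.prob g * ((∑ k, H.weight g k a * H.weight g k b) * (z a * z b)) := by
          simp only [Finset.mul_sum (s := (Finset.univ : Finset (Fin n → ZMod 2)))]
      _ = ∑ a, ∑ b, ∑ g,
          H.prob g * ((∑ k, H.weight g k a * H.weight g k b) * (z a * z b)) := by
          rw [Finset.sum_comm]
          exact Finset.sum_congr rfl fun a _ => Finset.sum_comm
      _ = _ := by
          simp only [← mul_assoc, ← Finset.sum_mul]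
  rw [e]
  set d := fun x => |H.vanishProb x - ((2 : ℝ) ^ m)⁻¹|
  have hd : ∑ x, d x ≤ 2 := H.sum_abs_vanishProb_sub_le hH
  -- Schur test: with `|z a z b| ≤ (z a² + z b²) / 2`, only the absolute sum of the kernel matters.
  calc ∑ a, ∑ b, (H.vanishProb (a - b) - ((2 : ℝ) ^ m)⁻¹) * (z a * z b)
      ≤ ∑ a, ∑ b, (d (a - b) * z a ^ 2 / 2 + d (a - b) * z b ^ 2 / 2) := by
        refine Finset.sum_le_sum fun a _ => Finset.sum_le_sum fun b _ => ?_
        refine (le_abs_self _).trans ?_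
        rw [abs_mul]
        have : |z a * z b| ≤ z a ^ 2 / 2 + z b ^ 2 / 2 := by
          rw [abs_mul]
          nlinarith [sq_nonneg (|z a| - |z b|), sq_abs (z a), sq_abs (z b)]
        calc _ ≤ d (a - b) * (z a ^ 2 / 2 + z b ^ 2 / 2) :=
              mul_le_mul_of_nonneg_left this (abs_nonneg _)
          _ = _ := by ring
    _ = (∑ x, d x) * ∑ a, z a ^ 2 := by
        simp only [Finset.sum_add_distrib]
        have h1 : ∑ a, ∑ b, d (a - b) * z a ^ 2 / 2 = (∑ x, d x) * (∑ a, z a ^ 2) / 2 := by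
          rw [Finset.mul_sum, Finset.sum_div]
          refine Finset.sum_congr rfl fun a _ => ?_
          rw [Finset.sum_mul, Finset.sum_div]
          exact (Equiv.subLeft a).sum_comp fun x => d x * z a ^ 2 / 2
        have h2 : ∑ a, ∑ b, d (a - b) * z b ^ 2 / 2 = (∑ x, d x) * (∑ a, z a ^ 2) / 2 := by
          rw [Finset.sum_comm, Finset.mul_sum, Finset.sum_div]
          refine Finset.sum_congr rfl fun b _ => ?_
          rw [Finset.sum_mul, Finset.sum_div]
          exact (Equiv.subRight b).sum_comp fun x => d x * z b ^ 2 / 2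
        rw [h1, h2]; ring
    _ ≤ 2 * ∑ a, z a ^ 2 :=
        mul_le_mul_of_nonneg_right hd (Finset.sum_nonneg fun _ _ => sq_nonneg _)

end RandomHash
end PrivacyAmplification

/-! ### Hash deviations of operator families -/

namespace PrivacyAmplification
open Matrix
namespace RandomHash
variable {n m : ℕ} {G E : Type*} [Fintype G] [Fintype E] (H : RandomHash n m G)

/-- `∑_{a ∈ g⁻¹(k)} Xₐ - 2^(-m) ∑ₐ Xₐ`. -/
noncomputable def deviation {Y : Type*} (X : (Fin n → ZMod 2) → Matrix E Y ℂ)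
    (g : G) (k : Fin m → ZMod 2) : Matrix E Y ℂ :=
  ∑ a, (H.weight g k a : ℂ) • X a

/-- The scalar variance bound applies to the real and imaginary parts of each matrix entry. -/
theorem variance_hsSq_le {Y : Type*} [Fintype Y] (hH : H.IsUniversalTwo)
    (X : (Fin n → ZMod 2) → Matrix E Y ℂ) :
    ∑ g, H.prob g * ∑ k, hsSq (H.deviation X g k) ≤ 2 * ∑ a, hsSq (X a) := by
  have e (g k i j) : ‖H.deviation X g k i j‖ ^ 2 = (∑ a, H.weight g k a * (X a i j).re) ^ 2
      + (∑ a, H.weight g k a * (X a i j).im) ^ 2 := by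
    rw [← Complex.normSq_eq_norm_sq, Complex.normSq_apply, deviation, Matrix.sum_apply]
    simp only [Matrix.smul_apply, smul_eq_mul, Complex.re_sum, Complex.im_sum,
      Complex.re_ofReal_mul, Complex.im_ofReal_mul]
    ring
  have h (i : E) (j : Y) : ∑ g, H.prob g * ∑ k, ‖H.deviation X g k i j‖ ^ 2
      ≤ 2 * ∑ a, ‖X a i j‖ ^ 2 := by
    have h1 := H.variance_le hH fun a => (X a i j).re
    have h2 := H.variance_le hH fun a => (X a i j).im
    simp only [e, Finset.sum_add_distrib, mul_add]
    refine (add_le_add h1 h2).trans (le_of_eq ?_)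
    rw [← mul_add, ← Finset.sum_add_distrib]
    congr 1
    refine Finset.sum_congr rfl fun a _ => ?_
    rw [← Complex.normSq_eq_norm_sq, Complex.normSq_apply]
    ring
  have swap (f : G → (Fin m → ZMod 2) → E → Y → ℝ) :
      ∑ g, H.prob g * ∑ k, ∑ i, ∑ j, f g k i j
        = ∑ i, ∑ j, ∑ g, H.prob g * ∑ k, f g k i j := by
    have h1 (g) : H.prob g * ∑ k, ∑ i, ∑ j, f g k i j
        = ∑ i, ∑ j, H.prob g * ∑ k, f g k i j := by
      simp only [← Finset.mul_sum]
      rw [Finset.sum_comm]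
      congr 1
      exact Finset.sum_congr rfl fun i _ => Finset.sum_comm
    simp only [h1]
    rw [Finset.sum_comm]
    exact Finset.sum_congr rfl fun i _ => Finset.sum_comm
  have swap' : ∑ a, hsSq (X a) = ∑ i, ∑ j, ∑ a, ‖X a i j‖ ^ 2 := by
    simp only [hsSq]
    rw [Finset.sum_comm]
    exact Finset.sum_congr rfl fun i _ => Finset.sum_comm
  rw [swap']
  simp only [hsSq]
  rw [swap]
  simp only [Finset.mul_sum (a := (2 : ℝ))] at h ⊢
  exact Finset.sum_le_sum fun i _ => Finset.sum_le_sum fun j _ => h i j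

/-- Cauchy-Schwarz over pairs `(g, k)` weighted by `H.prob g`; the total weight is `2^m`. -/
theorem sum_sqrt_hsSq_deviation_le {Y : Type*} [Fintype Y] (hH : H.IsUniversalTwo)
    (X : (Fin n → ZMod 2) → Matrix E Y ℂ) :
    ∑ g, H.prob g * ∑ k, √(hsSq (H.deviation X g k)) ≤ √(2 ^ m * (2 * ∑ a, hsSq (X a))) := by
  have h := Finset.sum_mul_sq_le_sq_mul_sq (Finset.univ : Finset (G × (Fin m → ZMod 2)))
    (fun p => √(H.prob p.1)) (fun p => √(H.prob p.1) * √(hsSq (H.deviation X p.1 p.2)))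
  simp only [Fintype.sum_prod_type, ← mul_assoc, Real.mul_self_sqrt (H.prob_nonneg _), mul_pow,
    Real.sq_sqrt (H.prob_nonneg _), Real.sq_sqrt (hsSq_nonneg _), Finset.sum_const,
    Finset.card_univ, nsmul_eq_mul, card_bits, ← Finset.mul_sum, H.prob_sum, mul_one] at h
  refine Real.le_sqrt_of_sq_le (h.trans ?_)
  exact mul_le_mul_of_nonneg_left (H.variance_hsSq_le hH X) (by positivity)

theorem deviation_mul_left {Y : Type*} (s : Matrix E E ℂ)
    (X : (Fin n → ZMod 2) → Matrix E Y ℂ) (g : G) (k : Fin m → ZMod 2) :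
    H.deviation (fun a => s * X a) g k = s * H.deviation X g k := by
  simp [deviation, Matrix.mul_sum]

omit [Fintype E] in
theorem deviation_conjTranspose (X : (Fin n → ZMod 2) → Matrix E E ℂ) (g : G)
    (k : Fin m → ZMod 2) :
    (H.deviation X g k)ᴴ = H.deviation (fun a => (X a)ᴴ) g k := by
  simp [deviation, Matrix.conjTranspose_sum]

/-- The common left factor `s` leaves the deviation and costs at most 1 by Cauchy-Schwarz, while `B
a` costs a factor `c` in squared norm. -/
theorem abs_sum_trace_deviation_le [DecidableEq E] {R : Type*} [Fintype R]
    (hH : H.IsUniversalTwo) {c : ℝ} (hc : 0 ≤ c)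
    {s : Matrix E E ℂ} (hs : hsSq s ≤ 1) {B M : (Fin n → ZMod 2) → Matrix E R ℂ}
    (hB : ∀ a, ((c : ℂ) • (1 : Matrix E E ℂ) - B a * (B a)ᴴ).PosSemidef)
    (hM : ∑ a, hsSq (M a) ≤ 1) {W : G → (Fin m → ZMod 2) → Matrix E E ℂ}
    (hW : ∀ g k (A : Matrix E E ℂ), hsSq (A * W g k) ≤ 1 * hsSq A) :
    |∑ g, H.prob g * ∑ k,
      (H.deviation (fun a => s * B a * (M a)ᴴ) g k * W g k).trace.re| ≤ √(2 ^ m * (2 * c)) := by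
  have h1 : ∑ g, H.prob g * ∑ k, √(hsSq (H.deviation (fun a => B a * (M a)ᴴ) g k))
      ≤ √(2 ^ m * (2 * c)) := by
    refine (H.sum_sqrt_hsSq_deviation_le hH _).trans (Real.sqrt_le_sqrt ?_)
    refine mul_le_mul_of_nonneg_left ?_ (by positivity)
    refine mul_le_mul_of_nonneg_left ?_ (by positivity)
    calc ∑ a, hsSq (B a * (M a)ᴴ) ≤ ∑ a, c * hsSq (M a) := by
          refine Finset.sum_le_sum fun a _ => ?_
          have := hsSq_mul_conjTranspose_le hc (hsSq_mul_le (X := E) (hB a)) (M a)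
          rwa [← hsSq_conjTranspose, Matrix.conjTranspose_mul,
            Matrix.conjTranspose_conjTranspose] at this
      _ = c * ∑ a, hsSq (M a) := by rw [Finset.mul_sum]
      _ ≤ c * 1 := mul_le_mul_of_nonneg_left hM hc
      _ = c := mul_one c
  refine le_trans ?_ h1
  refine (Finset.abs_sum_le_sum_abs _ _).trans (Finset.sum_le_sum fun g _ => ?_)
  rw [abs_mul, abs_of_nonneg (H.prob_nonneg g)]
  refine mul_le_mul_of_nonneg_left ?_ (H.prob_nonneg g)
  refine (Finset.abs_sum_le_sum_abs _ _).trans (Finset.sum_le_sum fun k _ => ?_)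
  refine (Complex.abs_re_le_norm _).trans ?_
  simp only [Matrix.mul_assoc]
  rw [deviation_mul_left, Matrix.mul_assoc]
  refine (norm_trace_mul_le _ _).trans ?_
  calc _ ≤ 1 * √(hsSq (H.deviation (fun a => B a * (M a)ᴴ) g k)) := by
        refine mul_le_mul ?_ (Real.sqrt_le_sqrt ?_) (Real.sqrt_nonneg _) zero_le_one
        · rw [← Real.sqrt_one]; exact Real.sqrt_le_sqrt hs
        · have := hW g k (H.deviation (fun a => B a * (M a)ᴴ) g k)
          rwa [one_mul] at this
    _ = _ := one_mul _

/-- Adjoint form of the previous bound: the real part of a trace is unchanged by taking adjoints. -/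
theorem abs_sum_trace_deviation_le' [DecidableEq E] {R : Type*} [Fintype R]
    (hH : H.IsUniversalTwo) {c : ℝ} (hc : 0 ≤ c)
    {s : Matrix E E ℂ} (hs : hsSq s ≤ 1) {B M : (Fin n → ZMod 2) → Matrix E R ℂ}
    (hB : ∀ a, ((c : ℂ) • (1 : Matrix E E ℂ) - B a * (B a)ᴴ).PosSemidef)
    (hM : ∑ a, hsSq (M a) ≤ 1) {W : G → (Fin m → ZMod 2) → Matrix E E ℂ}
    (hW : ∀ g k (A : Matrix E E ℂ), hsSq (A * W g k) ≤ 1 * hsSq A) :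
    |∑ g, H.prob g * ∑ k,
      (H.deviation (fun a => M a * (s * B a)ᴴ) g k * W g k).trace.re| ≤ √(2 ^ m * (2 * c)) := by
  have hW' (g k) (A : Matrix E E ℂ) : hsSq (A * (W g k)ᴴ) ≤ 1 * hsSq A :=
    hsSq_mul_conjTranspose_le zero_le_one (hW g k) A
  have e (g k) : (H.deviation (fun a => M a * (s * B a)ᴴ) g k * W g k).trace.re
      = (H.deviation (fun a => s * B a * (M a)ᴴ) g k * (W g k)ᴴ).trace.re := by
    have e : H.deviation (fun a => s * B a * (M a)ᴴ) g k
        = (H.deviation (fun a => M a * (s * B a)ᴴ) g k)ᴴ := by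
      rw [deviation_conjTranspose]
      simp only [Matrix.conjTranspose_mul, Matrix.conjTranspose_conjTranspose]
    rw [e, Matrix.trace_mul_comm, ← Matrix.conjTranspose_mul, Matrix.trace_conjTranspose,
      Complex.star_def, Complex.conj_re]
  simp only [e]
  exact H.abs_sum_trace_deviation_le hH hc hs hB hM hW'

/-- Universality plays no role: for each `g` and `a` the weights have absolute sum at most 2 over
`k`. -/
theorem sum_trace_deviation_self_le {R : Type*} [Fintype R]
    (D : (Fin n → ZMod 2) → Matrix E R ℂ) {W : G → (Fin m → ZMod 2) → Matrix E E ℂ}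
    (hW : ∀ g k (A : Matrix R E ℂ), hsSq (A * W g k) ≤ 1 * hsSq A) :
    ∑ g, H.prob g * ∑ k,
      (H.deviation (fun a => D a * (D a)ᴴ) g k * W g k).trace.re ≤ 2 * ∑ a, hsSq (D a) := by
  have h1 (g k a) : |(D a * (D a)ᴴ * W g k).trace.re| ≤ hsSq (D a) := by
    refine (Complex.abs_re_le_norm _).trans ?_
    rw [Matrix.mul_assoc]
    refine (norm_trace_mul_le _ _).trans ?_
    have h2 := hW g k (D a)ᴴ
    rw [one_mul, hsSq_conjTranspose] at h2
    calc _ ≤ √(hsSq (D a)) * √(hsSq (D a)) :=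
          mul_le_mul_of_nonneg_left (Real.sqrt_le_sqrt h2) (Real.sqrt_nonneg _)
      _ = _ := Real.mul_self_sqrt (hsSq_nonneg _)
  calc _ = ∑ g, H.prob g * ∑ k, ∑ a, H.weight g k a * (D a * (D a)ᴴ * W g k).trace.re := by
        simp [deviation, Matrix.sum_mul, Matrix.trace_sum]
    _ ≤ ∑ g, H.prob g * ∑ k, ∑ a, |H.weight g k a| * hsSq (D a) := by
        refine Finset.sum_le_sum fun g _ => mul_le_mul_of_nonneg_left ?_ (H.prob_nonneg g)
        refine Finset.sum_le_sum fun k _ => Finset.sum_le_sum fun a _ => ?_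
        refine (le_abs_self _).trans ?_
        rw [abs_mul]
        exact mul_le_mul_of_nonneg_left (h1 g k a) (abs_nonneg _)
    _ ≤ ∑ g, H.prob g * (2 * ∑ a, hsSq (D a)) := by
        refine Finset.sum_le_sum fun g _ => mul_le_mul_of_nonneg_left ?_ (H.prob_nonneg g)
        rw [Finset.sum_comm, Finset.mul_sum]
        refine Finset.sum_le_sum fun a _ => ?_
        rw [← Finset.sum_mul]
        exact mul_le_mul_of_nonneg_right (H.sum_abs_weight_le g a) (hsSq_nonneg _)
    _ = _ := by rw [← Finset.sum_mul, H.prob_sum, one_mul]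

end RandomHash

/-! ### Block structure of the classical registers -/

theorem cqState_apply {X E : Type*} [Fintype X] [DecidableEq X]
    (ρ : X → Matrix E E ℂ) (x y : X) (i j : E) :
    cqState ρ (x, i) (y, j) = if x = y then ρ x i j else 0 := by
  rw [cqState, Matrix.sum_apply]
  simp only [kroneckerMap_apply, Matrix.single_apply]
  split_ifs with h
  · subst h
    simp
  · refine Finset.sum_eq_zero fun z _ => ?_
    rw [if_neg, zero_mul]
    rintro ⟨rfl, rfl⟩
    exact h rfl

namespace RandomHash
variable {n m : ℕ} {G E : Type*} [Fintype G] [Fintype E] (H : RandomHash n m G)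

omit [Fintype E] in
theorem finalKEG_sub_idealKEG_apply [DecidableEq G] (ρ : (Fin n → ZMod 2) → Matrix E E ℂ)
    (k k' : Fin m → ZMod 2) (i j : E) (g g' : G) :
    (H.finalKEG ρ - H.idealKEG ρ) ((k, i), g) ((k', j), g')
      = if g = g' then if k = k' then (H.prob g : ℂ) * H.deviation ρ g k i j else 0 else 0 := by
  have h (k g) : H.deviation ρ g k i j
      = (∑ a with H.fn g a = k, ρ a) i j - ((2 : ℂ) ^ m)⁻¹ * (∑ a, ρ a) i j := by
    simp only [deviation, weight, Matrix.sum_apply, Matrix.smul_apply, smul_eq_mul,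
      Finset.sum_filter, Finset.mul_sum, ← Finset.sum_sub_distrib]
    refine Finset.sum_congr rfl fun a _ => ?_
    split_ifs <;> simp [sub_mul]
  have hs (R : G → Matrix ((Fin m → ZMod 2) × E) ((Fin m → ZMod 2) × E) ℂ) :
      (∑ g, (H.prob g : ℂ) • (R g ⊗ₖ Matrix.single g g (1 : ℂ))) ((k, i), g) ((k', j), g')
        = if g = g' then (H.prob g : ℂ) * R g (k, i) (k', j) else 0 := by
    rw [Matrix.sum_apply]
    simp only [Matrix.smul_apply, kroneckerMap_apply, Matrix.single_apply, smul_eq_mul]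
    split_ifs with h
    · subst h
      simp
    · refine Finset.sum_eq_zero fun z _ => ?_
      rw [if_neg, mul_zero, mul_zero]
      rintro ⟨rfl, rfl⟩
      exact h rfl
  rw [Matrix.sub_apply, finalKEG, idealKEG, hs, hs, finalKE, idealKE, Matrix.smul_apply,
    cqState_apply, cqState_apply, h]
  split_ifs <;> simp [mul_sub]

/-- The difference is block diagonal in `k` and `g`, so only the diagonal blocks of `W` contribute.
-/
theorem trace_finalKEG_sub_idealKEG_mul [DecidableEq G] (ρ : (Fin n → ZMod 2) → Matrix E E ℂ)
    (W : Matrix (((Fin m → ZMod 2) × E) × G) (((Fin m → ZMod 2) × E) × G) ℂ) :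
    ((H.finalKEG ρ - H.idealKEG ρ) * W).trace.re
      = ∑ g, H.prob g * ∑ k, (H.deviation ρ g k *
          W.submatrix (fun i => ((k, i), g)) fun i => ((k, i), g)).trace.re := by
  simp only [Matrix.trace, Matrix.diag, Matrix.mul_apply, Fintype.sum_prod_type,
    finalKEG_sub_idealKEG_apply, ite_mul, zero_mul, Finset.sum_ite_eq, Finset.mem_univ, if_true,
    Finset.sum_ite_irrel, Finset.sum_const_zero, Matrix.submatrix_apply]
  calc _ = (∑ k, ∑ g, ∑ i, ∑ j, (H.prob g : ℂ) * (H.deviation ρ g k i j *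
          W ((k, j), g) ((k, i), g))).re := by
        congr 1
        refine Finset.sum_congr rfl fun k _ => ?_
        rw [Finset.sum_comm]
        simp only [mul_assoc]
    _ = _ := by
        rw [Finset.sum_comm]
        simp only [← Finset.mul_sum, Complex.re_sum, Complex.re_ofReal_mul]

end RandomHash
end PrivacyAmplification

/-! ### The bound for a fixed smoothing state -/

namespace PrivacyAmplification
open Matrix

/-- A block of a contraction is a contraction: restricting rows keeps `W Wᴴ ≤ 1`, and dropping
columns only lowers the norm. -/
theorem hsSq_mul_submatrix_le {I J E : Type*} [Fintype I] [Fintype J] [DecidableEq J] [Fintype E]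
    [DecidableEq E]
    {W Q : Matrix J J ℂ} (h : W * Wᴴ + Q * Qᴴ = 1) {f : E → J} (hf : f.Injective)
    (A : Matrix I E ℂ) : hsSq (A * W.submatrix f f) ≤ 1 * hsSq A := by
  have e : A * W.submatrix f f = (A * W.submatrix f id).submatrix id f := by
    ext i j
    simp [Matrix.mul_apply]
  rw [e]
  refine (hsSq_submatrix_id_le _ hf).trans (hsSq_mul_le ?_ A)
  have e2 : ((1 : ℝ) : ℂ) • (1 : Matrix E E ℂ) - W.submatrix f id * (W.submatrix f id)ᴴ
      = (Q * Qᴴ).submatrix f f := by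
    have h1 : Q * Qᴴ = 1 - W * Wᴴ := by rw [← h]; abel
    rw [h1, Complex.ofReal_one, one_smul, Matrix.submatrix_sub, Matrix.conjTranspose_submatrix]
    rw [← Matrix.submatrix_one f hf]
    rfl
  rw [e2]
  exact (Matrix.posSemidef_self_mul_conjTranspose Q).submatrix f

namespace RandomHash
variable {n m : ℕ} {G E : Type*} [Fintype G] [Fintype E] (H : RandomHash n m G)

theorem d1_le [DecidableEq G] [DecidableEq E] (hH : H.IsUniversalTwo)
    {ρ : (Fin n → ZMod 2) → Matrix E E ℂ} (hρ : IsSubnormalized (cqState ρ))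
    {τ : Matrix ((Fin n → ZMod 2) × E) ((Fin n → ZMod 2) × E) ℂ} (hτ : IsSubnormalized τ)
    {ε : ℝ} (hP : purifiedDistance τ (cqState ρ) ≤ ε) {c : ℝ} (hc : 0 ≤ c)
    {σ : Matrix E E ℂ} (hσ : IsNormalized σ)
    (hτσ : ((c : ℂ) • ((1 : Matrix (Fin n → ZMod 2) (Fin n → ZMod 2) ℂ) ⊗ₖ σ) - τ).PosSemidef) :
    H.d1 ρ ≤ 2 * ε + 2 * √(2 ^ m * (2 * c)) := by
  obtain ⟨M, N, F, hM, hN, hF, hD, hD'⟩ := exists_close_purifications hρ hτ hP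
  obtain ⟨W, Q, hWQ, hW⟩ := exists_trace_mul_eq_traceNorm (H.finalKEG ρ - H.idealKEG ρ)
  set r : (Fin n → ZMod 2) → E → (Fin n → ZMod 2) × E := fun a i => (a, i)
  -- Only the diagonal blocks of the operator inequality are used, so `τ` may have coherences in
  -- `A`.
  have hNa (a) : ((c : ℂ) • σ - N.submatrix (r a) id * (N.submatrix (r a) id)ᴴ).PosSemidef := by
    have h := hτσ.submatrix (r a)
    convert h using 1
    ext i j
    rw [← hN]
    simp [r, Matrix.mul_apply]
  choose B hB hB' using fun a => exists_eq_psdSqrt_mul hc hσ.1 (hNa a)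
  set s := psdSqrt σ
  set Ma := fun a => M.submatrix (r a) id
  set Da := fun a => (M - (F : ℂ) • N).submatrix (r a) id
  have hsum (A : Matrix ((Fin n → ZMod 2) × E)
      (((Fin n → ZMod 2) × E) ⊕ ((Fin n → ZMod 2) × E)) ℂ) :
      ∑ a, hsSq (A.submatrix (r a) id) = hsSq A := by
    simp only [hsSq, Fintype.sum_prod_type]
    rfl
  have hs : hsSq s ≤ 1 := by
    rw [hsSq_eq_trace, psdSqrt_isHermitian, psdSqrt_mul_self hσ.1, hσ.2, Complex.one_re]
  have hMs : ∑ a, hsSq (Ma a) ≤ 1 := by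
    rw [hsum, hsSq_eq_trace, hM]; exact hρ.2
  have hDs : ∑ a, hsSq (Da a) ≤ 1 := by rwa [hsum]
  -- Keeping `Ma` unexpanded in the first term leaves just two terms linear in `s * B a`, and an
  -- error purely quadratic in `Da`.
  have hρa (a) : ρ a = (F : ℂ) • (s * B a * (Ma a)ᴴ) + (F : ℂ) • (Da a * (s * B a)ᴴ)
      + Da a * (Da a)ᴴ := by
    have h1 : ρ a = Ma a * (Ma a)ᴴ := by
      ext i j
      have := cqState_apply ρ a a i j
      rw [if_pos rfl, ← hM] at this
      rw [← this]
      simp [Ma, r, Matrix.mul_apply]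
    have h2 : Ma a = (F : ℂ) • (s * B a) + Da a := by
      rw [← hB]
      ext i j
      simp [Ma, Da]
    have h3 : (Ma a)ᴴ = (F : ℂ) • (s * B a)ᴴ + (Da a)ᴴ := by
      rw [h2]
      simp
    rw [h1]
    calc Ma a * (Ma a)ᴴ = (F : ℂ) • (s * B a * (Ma a)ᴴ) + Da a * (Ma a)ᴴ := by
          conv_lhs => rw [h2, Matrix.add_mul, Matrix.smul_mul, ← h2]
      _ = _ := by
          conv_lhs => rw [h3]
          rw [h3, Matrix.mul_add (Da a), Matrix.mul_smul (Da a), add_assoc]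
  have hdev (g k) : H.deviation ρ g k = (F : ℂ) • H.deviation (fun a => s * B a * (Ma a)ᴴ) g k
      + (F : ℂ) • H.deviation (fun a => Da a * (s * B a)ᴴ) g k
      + H.deviation (fun a => Da a * (Da a)ᴴ) g k := by
    simp only [deviation, Finset.smul_sum, ← Finset.sum_add_distrib]
    refine Finset.sum_congr rfl fun a _ => ?_
    conv_lhs => rw [hρa a, smul_add, smul_add]
    rw [smul_comm (F : ℂ), smul_comm (F : ℂ)]
  set Wb := fun (g : G) (k : Fin m → ZMod 2) =>
    W.submatrix (fun i : E => ((k, i), g)) fun i : E => ((k, i), g)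
  have hinj (g : G) (k : Fin m → ZMod 2) : (fun i : E => ((k, i), g)).Injective := by
    intro i j h
    simpa using h
  have t1 := H.abs_sum_trace_deviation_le hH hc hs hB' hMs (W := Wb)
    fun g k A => hsSq_mul_submatrix_le hWQ (hinj g k) A
  have t2 := H.abs_sum_trace_deviation_le' hH hc hs hB' hDs (W := Wb)
    fun g k A => hsSq_mul_submatrix_le hWQ (hinj g k) A
  have t3 := H.sum_trace_deviation_self_le Da (W := Wb)
    fun g k A => hsSq_mul_submatrix_le hWQ (hinj g k) A
  rw [hsum] at t3
  rw [d1, ← hW, trace_finalKEG_sub_idealKEG_mul]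
  simp only [hdev, Matrix.add_mul, Matrix.smul_mul, Matrix.trace_add, Matrix.trace_smul,
    smul_eq_mul, Complex.add_re, Complex.re_ofReal_mul, Finset.sum_add_distrib, mul_add,
    ← Finset.mul_sum, mul_left_comm _ F]
  have hbound {x y : ℝ} (h : |x| ≤ y) : F * x ≤ y :=
    calc F * x ≤ |F| * |x| := (le_abs_self _).trans (abs_mul _ _).le
      _ ≤ 1 * |x| := mul_le_mul_of_nonneg_right hF (abs_nonneg _)
      _ ≤ y := by rwa [one_mul]
  have := hbound t1
  have := hbound t2
  linarith

end RandomHash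

/-! ### Passage to the smooth min-entropy -/

/-- Origin of the 3: the outer 2 counts the two mixed terms and the inner 2 is the variance
constant, giving `2√2 = 2^(3/2)`. -/
theorem two_mul_sqrt_eq (m : ℕ) (r : ℝ) :
    2 * √(2 ^ m * (2 * 2 ^ (-r))) = (2 : ℝ) ^ ((m - r + 3) / 2) := by
  have h : (2 : ℝ) ^ m * (2 * 2 ^ (-r)) = 2 ^ (m + 1 - r : ℝ) := by
    rw [sub_eq_add_neg, Real.rpow_add two_pos, Real.rpow_add two_pos, Real.rpow_natCast,
      Real.rpow_one, mul_assoc]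
  have h' : (m - r + 3) / 2 = 1 + (m + 1 - r) * (1 / 2) := by ring
  rw [h, Real.sqrt_eq_rpow, ← Real.rpow_mul two_pos.le, h', Real.rpow_add two_pos, Real.rpow_one]

theorem exp2_coe (x : ℝ) : exp2 x = ENNReal.ofReal (2 ^ x) := by
  rw [exp2, ← EReal.coe_mul, EReal.exp_coe, Real.rpow_def_of_pos two_pos]

theorem exp2_mono {x y : EReal} (h : x ≤ y) : exp2 x ≤ exp2 y := by
  unfold exp2
  gcongr


end PrivacyAmplification

theorem mainTheorem3 {n m : ℕ} {E G : Type*} [Fintype E] [DecidableEq E]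
    [Fintype G] [DecidableEq G]
    (H : PrivacyAmplification.RandomHash n m G) (hH : H.IsUniversalTwo)
    (ρ : (Fin n → ZMod 2) → Matrix E E ℂ)
    (hρ : PrivacyAmplification.IsSubnormalized (PrivacyAmplification.cqState ρ))
    (ε : ℝ) (hε : 0 ≤ ε) :
    ((H.d1 ρ : ℝ) : EReal) ≤ ((2 * ε : ℝ) : EReal) +
      (PrivacyAmplification.exp2 (((1 / 2 : ℝ) : EReal) *
        ((m : EReal) -
          PrivacyAmplification.smoothMinEntropy ε (PrivacyAmplification.cqState ρ) + 3)) :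
        EReal) := by
  rcases le_or_gt (H.d1 ρ) (2 * ε) with h | h
  · refine (EReal.coe_le_coe_iff.mpr h).trans ?_
    exact le_add_of_nonneg_right (EReal.coe_ennreal_nonneg _)
  set y := H.d1 ρ - 2 * ε with hy
  have hy0 : 0 < y := sub_pos.mpr h
  -- `R` solves `2^((m - R + 3)/2) = y`. Bounding every admissible `r` by `R` bounds the supremum
  -- without its being attained and excludes the value `⊤`.
  set R : ℝ := m + 3 - 2 * Real.logb 2 y with hR
  have hS : PrivacyAmplification.smoothMinEntropy ε (PrivacyAmplification.cqState ρ) ≤ R := by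
    refine iSup₂_le fun τ hτ => iSup₂_le fun r hr => ?_
    obtain ⟨σ, hσ, hτσ⟩ := hr
    have h1 := H.d1_le hH hρ hτ.1 hτ.2 (by positivity) hσ hτσ
    rw [PrivacyAmplification.two_mul_sqrt_eq] at h1
    have h2 : y ≤ (2 : ℝ) ^ ((m - r + 3) / 2) := by linarith
    have h3 := (Real.logb_le_iff_le_rpow one_lt_two hy0).mpr h2
    rw [EReal.coe_le_coe_iff]
    linarith
  have hyR : y = (2 : ℝ) ^ ((1 / 2) * (m - R + 3)) := by
    rw [hR, show (1 / 2 : ℝ) * (m - (m + 3 - 2 * Real.logb 2 y) + 3) = Real.logb 2 y by ring,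
      Real.rpow_logb two_pos (by norm_num) hy0]
  have key : ENNReal.ofReal y ≤ PrivacyAmplification.exp2 (((1 / 2 : ℝ) : EReal) * ((m : EReal) -
      PrivacyAmplification.smoothMinEntropy ε (PrivacyAmplification.cqState ρ) + 3)) := by
    rw [hyR, ← PrivacyAmplification.exp2_coe]
    refine PrivacyAmplification.exp2_mono ?_
    have e : (((1 / 2) * (m - R + 3) : ℝ) : EReal)
        = ((1 / 2 : ℝ) : EReal) * ((m : EReal) - R + 3) := by
      push_cast
      rfl
    rw [e]
    refine mul_le_mul_of_nonneg_left ?_ (by exact_mod_cast (by norm_num : (0 : ℝ) ≤ 1 / 2))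
    gcongr
    exact EReal.sub_le_sub le_rfl hS
  calc ((H.d1 ρ : ℝ) : EReal) = ((2 * ε : ℝ) : EReal) + ((y : ℝ) : EReal) := by
        rw [← EReal.coe_add, hy]; congr 1; ring
    _ = ((2 * ε : ℝ) : EReal) + ((ENNReal.ofReal y : ℝ≥0∞) : EReal) := by
        rw [EReal.coe_ennreal_ofReal, max_eq_left hy0.le]
    _ ≤ _ := add_le_add_right (EReal.coe_ennreal_le_coe_ennreal_iff.mpr key) _
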